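/- **Setting.** Let $Z$ be a (real, smooth) Banach manifold and $\Pi\colon D\to Z$ a smooth Banach vector bundle with a Hermitian structure: every fiber $D_z$ is a complex Hilbert space with scalar product $(\cdot\mid\cdot)_z$ (linear in the first variable), and for every trivialization $\Psi_V\colon V\times\mathcal E\to\Pi^{-1}(V)$, with $V\subseteq Z$ open and $\mathcal E$ a complex Hilbert space, the function $(z,x,y)\mapsto(\Psi_V(z,x)\mid\Psi_V(z,y))_z$ is smooth on $V\times\mathcal E\times\mathcal E$. A *reproducing kernel* on $\Pi$ is a continuous section $K$ of $\mathrm{Hom}(p_2^*\Pi,p_1^*\Pi)\to Z\times Z$, where $p_1,p_2\colon Z\times Z\to Z$ are the projections, so that $K(s,t)\colon D_t\to D_s$ is a bounded linear operator for all $s,t\in Z$, which is positive definite: $\sum_{j,l=1}^n (K(t_l,t_j)\eta_j\mid\eta_l)_{t_l}\ge 0$ for all $n\ge1$, $t_j\in Z$, $\eta_j\in D_{t_j}$. For $\xi\in D$ put $K_\xi:=K(\cdot,\Pi(\xi))\xi$, a section of $\Pi$. Let $\mathcal H^K$ be the Hilbert space completion of $\mathrm{span}\{K_\xi:\xi\in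 D\}$ with respect to the scalar product determined by $(K_\xi\mid K_\eta)_{\mathcal H^K}=(K(\Pi(\eta),\Pi(\xi))\xi\mid\eta)_{\Pi(\eta)}$. Put $\widehat K\colon D\to\mathcal H^K$, $\widehat K(\xi)=K_\xi$, and $\zeta_K\colon Z\to\mathrm{Gr}(\mathcal H^K)$, $\zeta_K(s)=\overline{\widehat K(D_s)}$. For a complex Hilbert space $\mathcal H$, $\mathrm{Gr}(\mathcal H)$ is the Banach manifold of all closed linear subspaces of $\mathcal H$, $p_{\mathcal S}$ is the orthogonal projection onto $\mathcal S\in\mathrm{Gr}(\mathcal H)$, and $\Pi_{\mathcal H}\colon\mathcal T(\mathcal H)=\{(\mathcal S,x)\mid x\in\mathcal S\}\to\mathrm{Gr}(\mathcal H)$ is the tautological bundle, with the scalar products of $\mathcal H$ on its fibers and with the kernel $Q_{\mathcal H}(\mathcal S_1,\mathcal S_2)=p_{\mathcal S_1}|_{\mathcal S_2}$. For a smooth map $\zeta\colon Z\to\mathrm{Gr}(\mathcal H)$, let $\Pi_\zeta\colon\mathcal D_\zeta=\{(s,x)\in Z\times\mathcal H\mid x\in\zeta(s)\}\to Z$, $(s,x)\mapsto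 s$, be the pull-back of $\Pi_{\mathcal H}$ through $\zeta$, with the kernel $K_\zeta(s,t)=p_{\zeta(s)}|_{\zeta(t)}$, and let $\psi_\zeta\colon\mathcal D_\zeta\to\mathcal T(\mathcal H)$, $\psi_\zeta(s,x)=(\zeta(s),x)$. A *quasimorphism* $\Theta=(\delta,\zeta)$ of Hermitian bundles from $\Pi\colon D\to Z$ to $\widetilde\Pi\colon\widetilde D\to\widetilde Z$ is a pair of maps $\delta\colon D\to\widetilde D$, $\zeta\colon Z\to\widetilde Z$ with $\zeta\circ\Pi=\widetilde\Pi\circ\delta$ whose restrictions $\delta_z\colon D_z\to\widetilde D_{\zeta(z)}$ are bounded linear operators; the pull-back of a kernel $\widetilde K$ on $\widetilde\Pi$ is $(\Theta^*\widetilde K)(s,t)=\delta_s^*\circ\widetilde K(\zeta(s),\zeta(t))\circ\delta_t$. The reproducing kernel $K$ is *admissible* if (a) it is a smooth section of $\mathrm{Hom}(p_2^*\Pi,p_1^*\Pi)$; (b) $K(s,s)\in\mathcal B(D_s)$ is invertible for every $s\in Z$; (c) $\zeta_K\colon Z\to\mathrm{Gr}(\mathcal H^K)$ is smooth. **Theorem.**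 Let $K$ be an admissible reproducing kernel on the Hermitian bundle $\Pi\colon D\to Z$. Put $\check K:=(\Pi,\widehat K)\colon D\to\mathcal D_{\zeta_K}$, $\Delta_{\zeta_K}:=(\check K,\mathrm{id}_Z)$, $\delta_K:=(\zeta_K\circ\Pi,\widehat K)\colon D\to\mathcal T(\mathcal H^K)$, $\Delta_K:=(\delta_K,\zeta_K)$ and $\psi_K:=\psi_{\zeta_K}$. Then: 1. $\check K$ is a diffeomorphism with $\Pi_{\zeta_K}\circ\check K=\mathrm{id}_Z\circ\Pi$, and $\Delta_{\zeta_K}$ is an isomorphism of smooth vector bundles from $\Pi$ onto the pull-back $\Pi_{\zeta_K}$ of the tautological bundle $\Pi_{\mathcal H^K}$ through $\zeta_K$. 2. The quasimorphism $\Delta_K$ is smooth (that is, $\delta_K$ and $\zeta_K$ are smooth) and factorizes as $\Delta_K=(\psi_K,\zeta_K)\circ\Delta_{\zeta_K}$; that is, $\delta_K=\psi_K\circ\check K$, where $\Pi_{\zeta_K}\circ\check K=\mathrm{id}_Z\circ\Pi$ and $\Pi_{\mathcal H^K}\circ\psi_K=\zeta_K\circ\Pi_{\zeta_K}$, so that $\Pi_{\mathcal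 H^K}\circ\delta_K=\zeta_K\circ\Pi$. 3. $K=\Delta_{\zeta_K}^*K_{\zeta_K}=\Delta_{\zeta_K}^*(\psi_K,\zeta_K)^*Q_{\mathcal H^K}=\Delta_K^*Q_{\mathcal H^K}$. -/

import Mathlib

open scoped ContDiff

universe u v w u₁ v₁ w₁ u₂ v₂ w₂

noncomputable section

/-! ## Banach manifolds -/

/-- A smooth real Banach manifold structure on a set `M`, given by an atlas: charts are bijections
from subsets of `M` onto open subsets of real Banach spaces (which may vary from chart to chart),
the overlaps are open in the models, and the coordinate changes are smooth. -/
structure BanachAtlas (M : Type u) where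
  Index : Type w
  Model : Index → Type v
  [normedGroup : ∀ k, NormedAddCommGroup (Model k)]
  [normedSpace : ∀ k, NormedSpace ℝ (Model k)]
  [complete : ∀ k, CompleteSpace (Model k)]
  chart : ∀ k, PartialEquiv M (Model k)
  exists_chart : ∀ x, ∃ k, x ∈ (chart k).source
  isOpen_overlap : ∀ k l,
    IsOpen ((chart k).target ∩ (chart k).symm ⁻¹' (chart l).source)
  contDiffOn_change : ∀ k l,
    ContDiffOn ℝ ∞ (chart l ∘ (chart k).symm)
      ((chart k).target ∩ (chart k).symm ⁻¹' (chart l).source)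

attribute [instance] BanachAtlas.normedGroup BanachAtlas.normedSpace BanachAtlas.complete

namespace BanachAtlas

variable {M : Type u} {N : Type u₁} {P : Type u₂}

/-- The open sets of the manifold topology. -/
def IsOpenSet (A : BanachAtlas.{u, v, w} M) (V : Set M) : Prop :=
  ∀ k, IsOpen ((A.chart k).target ∩ (A.chart k).symm ⁻¹' V)

/-- Smoothness on an open set `V` of a function with values in a real normed space. -/
def SmoothOn (A : BanachAtlas.{u, v, w} M) {E : Type*} [NormedAddCommGroup E] [NormedSpace ℝ E]
    (V : Set M) (f : M → E) : Prop :=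
  ∀ k, ContDiffOn ℝ ∞ (f ∘ (A.chart k).symm) ((A.chart k).target ∩ (A.chart k).symm ⁻¹' V)

/-- Smooth maps between Banach manifolds: continuous and smooth in all charts (the openness of the
domains of all the coordinate expressions is part of the continuity). -/
def Smooth (A : BanachAtlas.{u, v, w} M) (B : BanachAtlas.{u₁, v₁, w₁} N) (f : M → N) : Prop :=
  ∀ k l,
    IsOpen ((A.chart k).target ∩ (A.chart k).symm ⁻¹' (f ⁻¹' (B.chart l).source)) ∧
    ContDiffOn ℝ ∞ (B.chart l ∘ f ∘ (A.chart k).symm)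
      ((A.chart k).target ∩ (A.chart k).symm ⁻¹' (f ⁻¹' (B.chart l).source))

/-- Diffeomorphisms: smooth bijections with smooth inverse. -/
def Diffeomorphism (A : BanachAtlas.{u, v, w} M) (B : BanachAtlas.{u₁, v₁, w₁} N)
    (f : M → N) : Prop :=
  A.Smooth B f ∧
    ∃ g : N → M, Function.LeftInverse g f ∧ Function.RightInverse g f ∧ B.Smooth A g

theorem isOpen_target (A : BanachAtlas.{u, v, w} M) (k : A.Index) :
    IsOpen (A.chart k).target := by
  have h : (A.chart k).target ∩ (A.chart k).symm ⁻¹' (A.chart k).source = (A.chart k).target :=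
    Set.inter_eq_left.2 (fun e he => (A.chart k).map_target he)
  exact h ▸ A.isOpen_overlap k k

theorem Smooth.id (A : BanachAtlas.{u, v, w} M) : A.Smooth A (fun x => x) :=
  fun k l => ⟨A.isOpen_overlap k l, A.contDiffOn_change k l⟩

theorem Smooth.isOpenSet_preimage {A : BanachAtlas.{u, v, w} M} {B : BanachAtlas.{u₁, v₁, w₁} N}
    {f : M → N} (hf : A.Smooth B f) {V : Set N} (hV : B.IsOpenSet V) :
    A.IsOpenSet (f ⁻¹' V) := by
  intro k
  rw [isOpen_iff_mem_nhds]
  rintro e ⟨he, heV⟩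
  obtain ⟨l, hl⟩ := B.exists_chart (f ((A.chart k).symm e))
  have h1 := (hf k l).2.continuousOn.isOpen_inter_preimage (hf k l).1 (hV l)
  refine Filter.mem_of_superset (h1.mem_nhds ⟨⟨he, hl⟩, (B.chart l).map_source hl, ?_⟩) ?_
  · change (B.chart l).symm ((B.chart l) (f ((A.chart k).symm e))) ∈ V
    rw [(B.chart l).left_inv hl]
    exact heV
  · rintro e' ⟨⟨h2, h3⟩, -, h5⟩
    refine ⟨h2, ?_⟩
    change (B.chart l).symm ((B.chart l) (f ((A.chart k).symm e'))) ∈ V at h5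
    rwa [(B.chart l).left_inv h3] at h5

theorem SmoothOn.comp {A : BanachAtlas.{u, v, w} M} {B : BanachAtlas.{u₁, v₁, w₁} N}
    {E : Type*} [NormedAddCommGroup E] [NormedSpace ℝ E] {V : Set N} {h : N → E}
    (hh : B.SmoothOn V h) {f : M → N} (hf : A.Smooth B f) :
    A.SmoothOn (f ⁻¹' V) (h ∘ f) := by
  rintro k e ⟨he, heV⟩
  obtain ⟨l, hl⟩ := B.exists_chart (f ((A.chart k).symm e))
  have h1 : ContDiffWithinAt ℝ ∞ ((h ∘ (B.chart l).symm) ∘ (B.chart l ∘ f ∘ (A.chart k).symm))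
      (((A.chart k).target ∩ (A.chart k).symm ⁻¹' (f ⁻¹' (B.chart l).source)) ∩
        (B.chart l ∘ f ∘ (A.chart k).symm) ⁻¹'
          ((B.chart l).target ∩ (B.chart l).symm ⁻¹' V)) e := by
    refine ContDiffWithinAt.comp e (hh l _ ⟨(B.chart l).map_source hl, ?_⟩)
      (((hf k l).2 e ⟨he, hl⟩).mono Set.inter_subset_left) (fun x hx => hx.2)
    change (B.chart l).symm ((B.chart l) (f ((A.chart k).symm e))) ∈ V
    rwa [(B.chart l).left_inv hl]
  have hopen := (hf k l).1.mem_nhds (x := e) ⟨he, hl⟩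
  refine (h1.mono_of_mem_nhdsWithin ?_).congr_of_eventuallyEq ?_ ?_
  · filter_upwards [self_mem_nhdsWithin, nhdsWithin_le_nhds hopen] with x hx hx'
    refine ⟨hx', (B.chart l).map_source hx'.2, ?_⟩
    change (B.chart l).symm ((B.chart l) (f ((A.chart k).symm x))) ∈ V
    rw [(B.chart l).left_inv hx'.2]
    exact hx.2
  · filter_upwards [nhdsWithin_le_nhds hopen] with x hx'
    exact congrArg h ((B.chart l).left_inv hx'.2).symm
  · exact congrArg h ((B.chart l).left_inv hl).symm

theorem Smooth.comp {A : BanachAtlas.{u, v, w} M} {B : BanachAtlas.{u₁, v₁, w₁} N}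
    {C : BanachAtlas.{u₂, v₂, w₂} P} {g : N → P} {f : M → N}
    (hg : B.Smooth C g) (hf : A.Smooth B f) : A.Smooth C (g ∘ f) := by
  intro k l
  have hV : B.IsOpenSet (g ⁻¹' (C.chart l).source) := fun m => (hg m l).1
  have hs : B.SmoothOn (g ⁻¹' (C.chart l).source) (C.chart l ∘ g) := fun m => (hg m l).2
  exact ⟨hf.isOpenSet_preimage hV k, hs.comp hf k⟩

end BanachAtlas

/-! ## Hermitian bundles -/

/-- A smooth Banach vector bundle with a Hermitian structure over the Banach manifold `(Z, A)`.
The fibers are `D z`, with total space `Σ z, D z` and projection `Sigma.fst`.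
Over the open set `dom i` of `Z` one has the trivialization whose restriction to the fiber over `z`
is the bijective bounded operator `toFib i z : D z → Fib i`, with inverse `ofFib i z`, where
`Fib i` is a complex Hilbert space (it may vary from one trivialization to another). -/
structure HermitianBundle {Z : Type u} (A : BanachAtlas.{u, v, w} Z) (D : Z → Type u₁)
    [∀ z, NormedAddCommGroup (D z)] [∀ z, InnerProductSpace ℂ (D z)]
    [∀ z, CompleteSpace (D z)] where
  Triv : Type w₁
  Fib : Triv → Type v₁
  [normedGroup : ∀ i, NormedAddCommGroup (Fib i)]
  [innerProduct : ∀ i, InnerProductSpace ℂ (Fib i)]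
  [complete : ∀ i, CompleteSpace (Fib i)]
  dom : Triv → Set Z
  isOpen_dom : ∀ i, A.IsOpenSet (dom i)
  exists_dom : ∀ z, ∃ i, z ∈ dom i
  toFib : ∀ i z, D z →L[ℂ] Fib i
  ofFib : ∀ i z, Fib i →L[ℂ] D z
  ofFib_toFib : ∀ i, ∀ z ∈ dom i, ∀ x, ofFib i z (toFib i z x) = x
  toFib_ofFib : ∀ i, ∀ z ∈ dom i, ∀ y, toFib i z (ofFib i z y) = y
  /-- The transition functions are smooth with respect to the operator norm. -/
  smooth_change : ∀ i j, A.SmoothOn (dom i ∩ dom j) (fun z => toFib j z ∘L ofFib i z)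
  /-- The scalar product is smooth when it is read in a trivialization. -/
  smooth_inner : ∀ i k, ContDiffOn ℝ ∞
    (fun p : A.Model k × Fib i × Fib i =>
      inner ℂ (ofFib i ((A.chart k).symm p.1) p.2.1) (ofFib i ((A.chart k).symm p.1) p.2.2))
    (((A.chart k).target ∩ (A.chart k).symm ⁻¹' dom i) ×ˢ Set.univ)

attribute [instance] HermitianBundle.normedGroup HermitianBundle.innerProduct
  HermitianBundle.complete

namespace HermitianBundle

section total

variable {Z : Type u} {A : BanachAtlas.{u, v, w} Z} {D : Z → Type u₁}
  [∀ z, NormedAddCommGroup (D z)] [∀ z, InnerProductSpace ℂ (D z)] [∀ z, CompleteSpace (D z)]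

/-- The chart of the total space obtained from a chart of the base and a trivialization. -/
def totalChart (B : HermitianBundle.{u, v, w, u₁, v₁, w₁} A D) (k : A.Index) (i : B.Triv) :
    PartialEquiv (Σ z, D z) (A.Model k × B.Fib i) where
  toFun p := (A.chart k p.1, B.toFib i p.1 p.2)
  invFun q := ⟨(A.chart k).symm q.1, B.ofFib i ((A.chart k).symm q.1) q.2⟩
  source := {p | p.1 ∈ (A.chart k).source ∩ B.dom i}
  target := ((A.chart k).target ∩ (A.chart k).symm ⁻¹' B.dom i) ×ˢ Set.univ
  map_source' := by
    rintro ⟨z, x⟩ ⟨h1, h2⟩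
    refine ⟨⟨(A.chart k).map_source h1, ?_⟩, Set.mem_univ _⟩
    change (A.chart k).symm (A.chart k z) ∈ B.dom i
    rwa [(A.chart k).left_inv h1]
  map_target' := by
    rintro ⟨e, y⟩ ⟨⟨h1, h2⟩, -⟩
    exact ⟨(A.chart k).map_target h1, h2⟩
  left_inv' := by
    rintro ⟨z, x⟩ ⟨h1, h2⟩
    have key : ∀ z', z' = z →
        (⟨z', B.ofFib i z' (B.toFib i z x)⟩ : Σ z, D z) = ⟨z, x⟩ := by
      rintro z' rfl
      rw [B.ofFib_toFib i z' h2]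
    exact key _ ((A.chart k).left_inv h1)
  right_inv' := by
    rintro ⟨e, y⟩ ⟨⟨h1, h2⟩, -⟩
    exact Prod.ext ((A.chart k).right_inv h1) (B.toFib_ofFib i _ h2 y)

theorem totalChart_overlap (B : HermitianBundle.{u, v, w, u₁, v₁, w₁} A D)
    (k l : A.Index) (i j : B.Triv) :
    (B.totalChart k i).target ∩ (B.totalChart k i).symm ⁻¹' (B.totalChart l j).source =
      (((A.chart k).target ∩ (A.chart k).symm ⁻¹' (A.chart l).source) ∩
        ((A.chart k).target ∩ (A.chart k).symm ⁻¹' B.dom i) ∩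
        ((A.chart k).target ∩ (A.chart k).symm ⁻¹' B.dom j)) ×ˢ Set.univ := by
  ext ⟨e, y⟩
  simp only [totalChart, Set.mem_inter_iff, Set.mem_prod, Set.mem_univ, Set.mem_preimage,
    Set.mem_ofPred_eq, PartialEquiv.coe_symm_mk]
  tauto

/-- The Banach manifold structure of the total space of a bundle. -/
def totalAtlas (B : HermitianBundle.{u, v, w, u₁, v₁, w₁} A D) :
    BanachAtlas.{max u u₁, max v v₁, max w w₁} (Σ z, D z) where
  Index := A.Index × B.Triv
  Model := fun κ => A.Model κ.1 × B.Fib κ.2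
  chart := fun κ => B.totalChart κ.1 κ.2
  exists_chart := by
    rintro ⟨z, x⟩
    obtain ⟨k, hk⟩ := A.exists_chart z
    obtain ⟨i, hi⟩ := B.exists_dom z
    exact ⟨(k, i), hk, hi⟩
  isOpen_overlap := by
    rintro ⟨k, i⟩ ⟨l, j⟩
    rw [totalChart_overlap]
    exact (((A.isOpen_overlap k l).inter (B.isOpen_dom i k)).inter (B.isOpen_dom j k)).prod
      isOpen_univ
  contDiffOn_change := by
    rintro ⟨k, i⟩ ⟨l, j⟩
    rw [totalChart_overlap]
    have h1 : ContDiffOn ℝ ∞ (fun p : A.Model k × B.Fib i => A.chart l ((A.chart k).symm p.1))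
        ((((A.chart k).target ∩ (A.chart k).symm ⁻¹' (A.chart l).source) ∩
        ((A.chart k).target ∩ (A.chart k).symm ⁻¹' B.dom i) ∩
        ((A.chart k).target ∩ (A.chart k).symm ⁻¹' B.dom j)) ×ˢ Set.univ) :=
      (A.contDiffOn_change k l).comp contDiff_fst.contDiffOn (fun p hp => hp.1.1.1)
    have h2 : ContDiffOn ℝ ∞ (fun p : A.Model k × B.Fib i =>
          (B.toFib j ((A.chart k).symm p.1) ∘L B.ofFib i ((A.chart k).symm p.1) :
            B.Fib i →L[ℂ] B.Fib j))
        ((((A.chart k).target ∩ (A.chart k).symm ⁻¹' (A.chart l).source) ∩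
        ((A.chart k).target ∩ (A.chart k).symm ⁻¹' B.dom i) ∩
        ((A.chart k).target ∩ (A.chart k).symm ⁻¹' B.dom j)) ×ˢ Set.univ) :=
      (B.smooth_change i j k).comp contDiff_fst.contDiffOn
        (fun p hp => ⟨hp.1.1.1.1, hp.1.1.2.2, hp.1.2.2⟩)
    have h3 : ContDiffOn ℝ ∞ (fun p : A.Model k × B.Fib i =>
          (ContinuousLinearMap.restrictScalarsL ℂ (B.Fib i) (B.Fib j) ℝ ℝ
            (B.toFib j ((A.chart k).symm p.1) ∘L B.ofFib i ((A.chart k).symm p.1))) p.2)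
        ((((A.chart k).target ∩ (A.chart k).symm ⁻¹' (A.chart l).source) ∩
        ((A.chart k).target ∩ (A.chart k).symm ⁻¹' B.dom i) ∩
        ((A.chart k).target ∩ (A.chart k).symm ⁻¹' B.dom j)) ×ˢ Set.univ) :=
      ((ContinuousLinearMap.contDiff _).comp_contDiffOn h2).clm_apply contDiff_snd.contDiffOn
    exact h1.prodMk h3

end total

/-- The pull-back of a Hermitian bundle through a smooth map `f`: the fiber at `z` is the fiber of
the given bundle at `f z`, and the trivializations are pulled back. -/
def pullback {Z : Type u} {A : BanachAtlas.{u, v, w} Z} {Y : Type u₂}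
    {C : BanachAtlas.{u₂, v₂, w₂} Y} {D : Y → Type u₁}
    [∀ z, NormedAddCommGroup (D z)] [∀ z, InnerProductSpace ℂ (D z)] [∀ z, CompleteSpace (D z)]
    (B : HermitianBundle.{u₂, v₂, w₂, u₁, v₁, w₁} C D) (f : Z → Y) (hf : A.Smooth C f) :
    HermitianBundle.{u, v, w, u₁, v₁, w₁} A (fun z => D (f z)) where
  Triv := B.Triv
  Fib := B.Fib
  dom := fun i => f ⁻¹' B.dom i
  isOpen_dom := fun i => hf.isOpenSet_preimage (B.isOpen_dom i)
  exists_dom := fun z => B.exists_dom (f z)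
  toFib := fun i z => B.toFib i (f z)
  ofFib := fun i z => B.ofFib i (f z)
  ofFib_toFib := fun i z hz => B.ofFib_toFib i (f z) hz
  toFib_ofFib := fun i z hz => B.toFib_ofFib i (f z) hz
  smooth_change := fun i j => (B.smooth_change i j).comp hf
  smooth_inner := by
    rintro i k ⟨e, y⟩ ⟨⟨he, heV⟩, -⟩
    obtain ⟨l, hl⟩ := C.exists_chart (f ((A.chart k).symm e))
    have hopen := (hf k l).1.mem_nhds (x := e) ⟨he, hl⟩
    have hb := B.smooth_inner i l (C.chart l (f ((A.chart k).symm e)), y)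
      ⟨⟨(C.chart l).map_source hl, by
        change (C.chart l).symm ((C.chart l) (f ((A.chart k).symm e))) ∈ B.dom i
        rw [(C.chart l).left_inv hl]
        exact heV⟩, Set.mem_univ _⟩
    have h0 : ContDiffWithinAt ℝ ∞ (C.chart l ∘ f ∘ (A.chart k).symm)
        ((A.chart k).target ∩ (A.chart k).symm ⁻¹' (f ⁻¹' (C.chart l).source)) e :=
      (hf k l).2 e ⟨he, hl⟩
    have h1 : ContDiffAt ℝ ∞ (fun p : A.Model k × B.Fib i × B.Fib i =>
        ((C.chart l (f ((A.chart k).symm p.1)), p.2) : C.Model l × B.Fib i × B.Fib i)) (e, y) :=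
      ((h0.contDiffAt hopen).comp (e, y) contDiffAt_fst).prodMk contDiffAt_snd
    have h2 := hb.comp_of_eq (e, y) h1.contDiffWithinAt
      (Set.mapsTo_preimage _ _) rfl
    have hopen' : ∀ᶠ p : A.Model k × B.Fib i × B.Fib i in nhds (e, y),
        p.1 ∈ ((A.chart k).target ∩ (A.chart k).symm ⁻¹' (f ⁻¹' (C.chart l).source)) :=
      continuous_fst.continuousAt.eventually hopen
    have heq : ∀ z z' : Y, z = z' → ∀ x y : B.Fib i,
        inner ℂ (B.ofFib i z x) (B.ofFib i z y) = inner ℂ (B.ofFib i z' x) (B.ofFib i z' y) := by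
      rintro z z' rfl x y
      rfl
    refine (h2.mono_of_mem_nhdsWithin ?_).congr_of_eventuallyEq ?_ ?_
    · filter_upwards [self_mem_nhdsWithin, nhdsWithin_le_nhds hopen'] with p hp hp'
      refine ⟨⟨(C.chart l).map_source hp'.2, ?_⟩, Set.mem_univ _⟩
      change (C.chart l).symm ((C.chart l) (f ((A.chart k).symm p.1))) ∈ B.dom i
      rw [(C.chart l).left_inv hp'.2]
      exact hp.1.2
    · filter_upwards [nhdsWithin_le_nhds hopen'] with p hp'
      exact heq _ _ ((C.chart l).left_inv hp'.2).symm _ _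
    · exact heq _ _ ((C.chart l).left_inv hl).symm _ _

end HermitianBundle

/-! ## The Grassmann manifold and its tautological bundle -/

/-- The Grassmannian of all the closed linear subspaces of a complex Hilbert space. -/
abbrev Gr (H : Type u) [NormedAddCommGroup H] [InnerProductSpace ℂ H] : Type u :=
  ClosedSubmodule ℂ H

namespace Gr

variable {H : Type u} [NormedAddCommGroup H] [InnerProductSpace ℂ H]

/-- A closed subspace as a space in its own right. -/
abbrev space (S : Gr H) : Type u := S.toSubmodule

variable [CompleteSpace H]

instance (S : Gr H) : CompleteSpace S.space := S.isClosed.completeSpace_coe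

/-- The restriction to `S` of the orthogonal projection onto `T`. -/
def proj (T S : Gr H) : S.space →L[ℂ] T.space :=
  T.toSubmodule.orthogonalProjectionOnto ∘L S.toSubmodule.subtypeL

/-- The domain of the chart at `S₀`: all `S` that are mapped isomorphically onto `S₀` by the
orthogonal projection, that is, all the closed complements of the orthogonal complement of `S₀`. -/
def chartDom (S₀ : Gr H) : Set (Gr H) := {S | (proj S₀ S).IsInvertible}

/-- The chart at `S₀`: every `S` in its domain is the graph of this operator. -/
def coord (S₀ S : Gr H) : S₀.space →L[ℂ] S₀.toSubmoduleᗮ :=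
  (S₀.toSubmoduleᗮ.orthogonalProjectionOnto ∘L S.toSubmodule.subtypeL) ∘L (proj S₀ S).inverse

/-- The graph of an operator from `S₀` into its orthogonal complement. -/
def graph (S₀ : Gr H) (a : S₀.space →L[ℂ] S₀.toSubmoduleᗮ) : Gr H where
  toSubmodule := (S₀.toSubmoduleᗮ.orthogonalProjectionOnto -
    a ∘L S₀.toSubmodule.orthogonalProjectionOnto).ker
  isClosed' := (S₀.toSubmoduleᗮ.orthogonalProjectionOnto -
    a ∘L S₀.toSubmodule.orthogonalProjectionOnto).isClosed_ker

theorem mem_graph (S₀ : Gr H) (a : S₀.space →L[ℂ] S₀.toSubmoduleᗮ) (x : H) :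
    x ∈ (graph S₀ a).toSubmodule ↔ S₀.toSubmoduleᗮ.orthogonalProjectionOnto x =
      a (S₀.toSubmodule.orthogonalProjectionOnto x) := by
  simp [graph, LinearMap.mem_ker, sub_eq_zero]

/-- The parametrization `x ↦ x + a x` of the graph of `a`. -/
def param (S₀ : Gr H) (a : S₀.space →L[ℂ] S₀.toSubmoduleᗮ) : S₀.space →L[ℂ] H :=
  S₀.toSubmodule.subtypeL + S₀.toSubmoduleᗮ.subtypeL ∘L a

theorem proj_param (S₀ : Gr H) (a : S₀.space →L[ℂ] S₀.toSubmoduleᗮ) (x : S₀.space) :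
    S₀.toSubmodule.orthogonalProjectionOnto (param S₀ a x) = x := by
  have h : S₀.toSubmodule.orthogonalProjectionOnto (a x : H) = 0 := by
    rw [Submodule.orthogonalProjectionOnto_eq_zero_iff]
    exact (a x).2
  simp [param, h]

theorem projPerp_param (S₀ : Gr H) (a : S₀.space →L[ℂ] S₀.toSubmoduleᗮ) (x : S₀.space) :
    S₀.toSubmoduleᗮ.orthogonalProjectionOnto (param S₀ a x) = a x := by
  have h : S₀.toSubmoduleᗮ.orthogonalProjectionOnto (x : H) = 0 := by
    rw [Submodule.orthogonalProjectionOnto_eq_zero_iff]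
    exact Submodule.le_orthogonal_orthogonal _ x.2
  simp [param, h]

theorem eq_of_proj_eq (S₀ : Gr H) {x y : H}
    (h1 : S₀.toSubmodule.orthogonalProjectionOnto x = S₀.toSubmodule.orthogonalProjectionOnto y)
    (h2 : S₀.toSubmoduleᗮ.orthogonalProjectionOnto x =
      S₀.toSubmoduleᗮ.orthogonalProjectionOnto y) : x = y := by
  rw [← sub_eq_zero, ← map_sub] at h1 h2
  rw [Submodule.orthogonalProjectionOnto_eq_zero_iff] at h1 h2
  rw [Submodule.orthogonal_orthogonal] at h2
  rw [← sub_eq_zero]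
  have := Submodule.inner_right_of_mem_orthogonal h2 h1
  exact inner_self_eq_zero.1 this

/-- The graph of `a` is isomorphic to `S₀`. -/
def graphEquiv (S₀ : Gr H) (a : S₀.space →L[ℂ] S₀.toSubmoduleᗮ) :
    S₀.space ≃L[ℂ] (graph S₀ a).space :=
  ContinuousLinearEquiv.equivOfInverse
    ((param S₀ a).codRestrict (graph S₀ a).toSubmodule (fun x => by
      rw [mem_graph, proj_param, projPerp_param]))
    (proj S₀ (graph S₀ a))
    (fun x => proj_param S₀ a x)
    (fun x => Subtype.ext (eq_of_proj_eq S₀ (proj_param S₀ a _)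
      ((projPerp_param S₀ a _).trans ((mem_graph S₀ a _).1 x.2).symm)))

theorem graphEquiv_coe (S₀ : Gr H) (a : S₀.space →L[ℂ] S₀.toSubmoduleᗮ) (x : S₀.space) :
    ((graphEquiv S₀ a x : (graph S₀ a).space) : H) = param S₀ a x := rfl

theorem proj_graph (S₀ : Gr H) (a : S₀.space →L[ℂ] S₀.toSubmoduleᗮ) :
    proj S₀ (graph S₀ a) = ((graphEquiv S₀ a).symm : (graph S₀ a).space →L[ℂ] S₀.space) := rfl

/-- The chart at `S₀` and its inverse. -/
def chart (S₀ : Gr H) : PartialEquiv (Gr H) (S₀.space →L[ℂ] S₀.toSubmoduleᗮ) where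
  toFun := coord S₀
  invFun := graph S₀
  source := chartDom S₀
  target := Set.univ
  map_source' := fun _ _ => Set.mem_univ _
  map_target' := fun a _ => ⟨(graphEquiv S₀ a).symm, rfl⟩
  left_inv' := by
    intro S hS
    apply ClosedSubmodule.toSubmodule_injective
    ext x
    rw [mem_graph]
    constructor
    · intro hx
      have h1 := hS.self_apply_inverse (S₀.toSubmodule.orthogonalProjectionOnto x)
      rw [eq_of_proj_eq S₀ h1.symm hx]
      exact SetLike.coe_mem _
    · intro hx
      have h1 := hS.inverse_apply_self ⟨x, hx⟩
      have h2 : proj S₀ S ⟨x, hx⟩ = S₀.toSubmodule.orthogonalProjectionOnto x := rfl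
      rw [h2] at h1
      simp [coord, h1]
  right_inv' := by
    intro a _
    ext1 x
    simp only [coord, proj_graph, ContinuousLinearMap.inverse_equiv, ContinuousLinearMap.comp_apply]
    exact projPerp_param S₀ a x

/-- The projection of the graph of `a` onto `S₁`, in terms of the parametrization. -/
theorem proj_graph_comp (S₀ S₁ : Gr H) (a : S₀.space →L[ℂ] S₀.toSubmoduleᗮ) :
    proj S₁ (graph S₀ a) ∘L (graphEquiv S₀ a : S₀.space →L[ℂ] (graph S₀ a).space) =
      S₁.toSubmodule.orthogonalProjectionOnto ∘L param S₀ a := rfl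

theorem graph_mem_chartDom (S₀ S₁ : Gr H) (a : S₀.space →L[ℂ] S₀.toSubmoduleᗮ) :
    graph S₀ a ∈ chartDom S₁ ↔
      (S₁.toSubmodule.orthogonalProjectionOnto ∘L param S₀ a).IsInvertible := by
  rw [← proj_graph_comp, ContinuousLinearMap.isInvertible_comp_equiv]
  rfl

theorem inverse_proj_graph (S₀ S₁ : Gr H) (a : S₀.space →L[ℂ] S₀.toSubmoduleᗮ) :
    (graph S₀ a).toSubmodule.subtypeL ∘L (proj S₁ (graph S₀ a)).inverse =
      param S₀ a ∘L (S₁.toSubmodule.orthogonalProjectionOnto ∘L param S₀ a).inverse := by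
  rw [← proj_graph_comp, ContinuousLinearMap.inverse_comp_equiv]
  ext y
  simp only [ContinuousLinearMap.comp_apply]
  change _ = ((graphEquiv S₀ a) ((graphEquiv S₀ a).symm _) : H)
  rw [ContinuousLinearEquiv.apply_symm_apply]
  rfl

theorem contDiff_param (S₀ : Gr H) : ContDiff ℂ ∞ (param S₀) :=
  contDiff_const.add (contDiff_const.clm_comp contDiff_id)

theorem contDiffOn_inverse_proj_graph (S₀ S₁ : Gr H) :
    ContDiffOn ℝ ∞ (fun a : S₀.space →L[ℂ] S₀.toSubmoduleᗮ =>
        ((graph S₀ a).toSubmodule.subtypeL ∘L (proj S₁ (graph S₀ a)).inverse))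
      (graph S₀ ⁻¹' chartDom S₁) := by
  intro a ha
  simp only [inverse_proj_graph]
  have h : (S₁.toSubmodule.orthogonalProjectionOnto ∘L param S₀ a).IsInvertible :=
    (graph_mem_chartDom S₀ S₁ a).1 ha
  have h1 : ContDiffAt ℂ ∞ (fun a => S₁.toSubmodule.orthogonalProjectionOnto ∘L param S₀ a) a :=
    contDiffAt_const.clm_comp (contDiff_param S₀).contDiffAt
  have h2 : ContDiffAt ℂ ∞ (fun a =>
      (S₁.toSubmodule.orthogonalProjectionOnto ∘L param S₀ a).inverse) a :=
    ContDiffAt.comp (g := ContinuousLinearMap.inverse) a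
      h.contDiffAt_map_inverse h1
  exact (((contDiff_param S₀).contDiffAt.clm_comp h2).restrict_scalars ℝ).contDiffWithinAt

theorem isOpen_preimage_chartDom (S₀ S₁ : Gr H) :
    IsOpen (graph S₀ ⁻¹' chartDom S₁) := by
  have h : graph S₀ ⁻¹' chartDom S₁ =
      (fun a => S₁.toSubmodule.orthogonalProjectionOnto ∘L param S₀ a) ⁻¹'
        Set.range ((↑) : (S₀.space ≃L[ℂ] S₁.space) → S₀.space →L[ℂ] S₁.space) := by
    ext a
    exact graph_mem_chartDom S₀ S₁ a
  rw [h]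
  exact (ContinuousLinearEquiv.isOpen).preimage
    (continuous_const.clm_comp (contDiff_param S₀).continuous)

variable (H) in
/-- The Banach manifold structure of the Grassmannian. -/
def atlas : BanachAtlas.{u, u, u} (Gr H) where
  Index := Gr H
  Model := fun S₀ => S₀.space →L[ℂ] S₀.toSubmoduleᗮ
  chart := chart
  exists_chart := fun S => ⟨S, by
    refine ⟨ContinuousLinearEquiv.refl ℂ _, ?_⟩
    ext x
    simp [proj]⟩
  isOpen_overlap := by
    intro S₀ S₁
    have h2 : (chart S₀).target ∩ (chart S₀).symm ⁻¹' (chart S₁).source =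
        graph S₀ ⁻¹' chartDom S₁ := Set.univ_inter _
    rw [h2]
    exact isOpen_preimage_chartDom S₀ S₁
  contDiffOn_change := by
    intro S₀ S₁
    have h : ContDiffOn ℝ ∞ (fun a : S₀.space →L[ℂ] S₀.toSubmoduleᗮ =>
        S₁.toSubmoduleᗮ.orthogonalProjectionOnto ∘L
          ((graph S₀ a).toSubmodule.subtypeL ∘L (proj S₁ (graph S₀ a)).inverse))
        (graph S₀ ⁻¹' chartDom S₁) := by
      have h1 : ContDiff ℝ ∞ (fun b : S₁.space →L[ℂ] H =>
          S₁.toSubmoduleᗮ.orthogonalProjectionOnto ∘L b) :=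
        ContDiff.restrict_scalars ℝ (𝕜' := ℂ) (contDiff_const.clm_comp contDiff_id)
      exact h1.comp_contDiffOn (contDiffOn_inverse_proj_graph S₀ S₁)
    have h2 : (chart S₀).target ∩ (chart S₀).symm ⁻¹' (chart S₁).source =
        graph S₀ ⁻¹' chartDom S₁ := Set.univ_inter _
    rw [h2]
    exact h

variable (H) in
/-- The tautological (universal) bundle: the fiber at `S` is `S` with the scalar product of `H`,
and near `S₀` it is trivialized by the orthogonal projection onto `S₀`. Its total space consists of
the pairs `(S, x)` with `x ∈ S`. -/
def tautological : HermitianBundle.{u, u, u, u, u, u} (atlas H) (fun S : Gr H => S.space) where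
  Triv := Gr H
  Fib := fun S₀ => S₀.space
  dom := chartDom
  isOpen_dom := fun S₁ S₀ => (atlas H).isOpen_overlap S₀ S₁
  exists_dom := (atlas H).exists_chart
  toFib := fun S₀ S => proj S₀ S
  ofFib := fun S₀ S => (proj S₀ S).inverse
  ofFib_toFib := fun S₀ S hS x => ContinuousLinearMap.IsInvertible.inverse_apply_self hS x
  toFib_ofFib := fun S₀ S hS y => ContinuousLinearMap.IsInvertible.self_apply_inverse hS y
  smooth_change := by
    intro S₁ S₂ S₀
    have h1 : ContDiff ℝ ∞ (fun b : S₁.space →L[ℂ] H =>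
        S₂.toSubmodule.orthogonalProjectionOnto ∘L b) :=
      ContDiff.restrict_scalars ℝ (𝕜' := ℂ) (contDiff_const.clm_comp contDiff_id)
    exact (h1.comp_contDiffOn (contDiffOn_inverse_proj_graph S₀ S₁)).mono (fun a ha => ha.2.1)
  smooth_inner := by
    intro S₁ S₀
    have h1 : ContDiffOn ℝ ∞ (fun p : (S₀.space →L[ℂ] S₀.toSubmoduleᗮ) × S₁.space × S₁.space =>
        ContinuousLinearMap.restrictScalarsL ℂ S₁.space H ℝ ℝ
          ((graph S₀ p.1).toSubmodule.subtypeL ∘L (proj S₁ (graph S₀ p.1)).inverse))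
        ((graph S₀ ⁻¹' chartDom S₁) ×ˢ Set.univ) :=
      (ContinuousLinearMap.contDiff _).comp_contDiffOn
        ((contDiffOn_inverse_proj_graph S₀ S₁).comp contDiff_fst.contDiffOn (fun p hp => hp.1))
    have h2 := (h1.clm_apply (contDiff_fst.comp contDiff_snd).contDiffOn).inner ℂ
      (h1.clm_apply (contDiff_snd.comp contDiff_snd).contDiffOn)
    exact h2.mono (fun p hp => ⟨hp.1.2, hp.2⟩)

end Gr

/-! ## Reproducing kernels -/

open scoped ComplexOrder ComplexConjugate

/-- A reproducing kernel on a Hermitian bundle: a continuous section of `Hom(p₂^*Π, p₁^*Π)` that is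
positive definite. The continuity is read in trivializations, with the operator norm. In the usual
convention `(x | y) = inner ℂ y x` is linear in the first variable. -/
structure ReproducingKernel {Z : Type u} {A : BanachAtlas.{u, v, w} Z} {D : Z → Type u₁}
    [∀ z, NormedAddCommGroup (D z)] [∀ z, InnerProductSpace ℂ (D z)] [∀ z, CompleteSpace (D z)]
    (B : HermitianBundle.{u, v, w, u₁, v₁, w₁} A D) where
  toFun : ∀ s t, D t →L[ℂ] D s
  continuousOn : ∀ i j k l, ContinuousOn
    (fun p : A.Model k × A.Model l =>
      (B.toFib i ((A.chart k).symm p.1) ∘L toFun ((A.chart k).symm p.1) ((A.chart l).symm p.2) ∘L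
        B.ofFib j ((A.chart l).symm p.2) : B.Fib j →L[ℂ] B.Fib i))
    (((A.chart k).target ∩ (A.chart k).symm ⁻¹' B.dom i) ×ˢ
      ((A.chart l).target ∩ (A.chart l).symm ⁻¹' B.dom j))
  posDef : ∀ (n : ℕ) (t : Fin n → Z) (η : ∀ j, D (t j)),
    0 ≤ ∑ j, ∑ l, inner ℂ (η l) (toFun (t l) (t j) (η j))

namespace ReproducingKernel

variable {Z : Type u} {A : BanachAtlas.{u, v, w} Z} {D : Z → Type u₁}
  [∀ z, NormedAddCommGroup (D z)] [∀ z, InnerProductSpace ℂ (D z)] [∀ z, CompleteSpace (D z)]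
  {B : HermitianBundle.{u, v, w, u₁, v₁, w₁} A D} (K : ReproducingKernel B)

theorem inner_symm (s t : Z) (ξ : D s) (η : D t) :
    inner ℂ ξ (K.toFun s t η) = conj (inner ℂ η (K.toFun t s ξ)) := by
  have key : ∀ (s t : Z) (ξ : D s) (η : D t),
      (inner ℂ ξ (K.toFun s s ξ) + inner ℂ η (K.toFun t s ξ) +
        (inner ℂ ξ (K.toFun s t η) + inner ℂ η (K.toFun t t η)) : ℂ).im = 0 := by
    intro s t ξ η
    have h := K.posDef 2 (Fin.cons s (Fin.cons t Fin.elim0))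
      (Fin.cons ξ (Fin.cons η (fun j => Fin.elim0 j)))
    simp only [Fin.sum_univ_two] at h
    exact (Complex.le_def.1 h).2.symm
  have hself : ∀ (s : Z) (ξ : D s), (inner ℂ ξ (K.toFun s s ξ) : ℂ).im = 0 := by
    intro s ξ
    have h := K.posDef 1 (fun _ => s) (fun _ => ξ)
    simp only [Fin.sum_univ_one] at h
    exact (Complex.le_def.1 h).2.symm
  have h1 := key s t ξ η
  have h2 := key s t ξ (Complex.I • η)
  have h3 := hself s ξ
  have h4 := hself t η
  simp only [map_smul, inner_smul_left, inner_smul_right, Complex.add_im, Complex.conj_I,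
    Complex.mul_im, Complex.neg_re, Complex.neg_im, Complex.I_re, Complex.I_im, Complex.mul_re]
    at h1 h2
  apply Complex.ext
  · simp only [Complex.conj_re]; linarith
  · simp only [Complex.conj_im]; linarith

/-- The section `K_ξ = K(·, Π(ξ)) ξ`. -/
def sec (ξ : Σ z, D z) : ∀ z, D z := fun s => K.toFun s ξ.1 ξ.2

/-- The span of the sections `K_ξ`. -/
def PreHilbert : Type (max u u₁) := Submodule.span ℂ (Set.range K.sec)

instance : AddCommGroup K.PreHilbert :=
  inferInstanceAs (AddCommGroup (Submodule.span ℂ (Set.range K.sec)))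

instance : Module ℂ K.PreHilbert :=
  inferInstanceAs (Module ℂ (Submodule.span ℂ (Set.range K.sec)))

/-- The section underlying an element of the span. -/
def toSection : K.PreHilbert →ₗ[ℂ] (∀ z, D z) := (Submodule.span ℂ (Set.range K.sec)).subtype

theorem toSection_injective : Function.Injective K.toSection := Subtype.val_injective

/-- `K_ξ` as an element of the span. -/
def preSec (ξ : Σ z, D z) : K.PreHilbert := ⟨K.sec ξ, Submodule.subset_span ⟨ξ, rfl⟩⟩

theorem toSection_preSec (ξ : Σ z, D z) : K.toSection (K.preSec ξ) = K.sec ξ := rfl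

/-- The coefficients of a presentation of an element of the span as a linear combination of
sections `K_ξ`. -/
def coeff (f : K.PreHilbert) : (Σ z, D z) →₀ ℂ :=
  ((Finsupp.mem_span_range_iff_exists_finsupp).1 f.2).choose

theorem coeff_spec (f : K.PreHilbert) (s : Z) :
    ((K.coeff f).sum fun ξ c => c • K.sec ξ s) = K.toSection f s := by
  have h := ((Finsupp.mem_span_range_iff_exists_finsupp).1 f.2).choose_spec
  have h2 := congrFun h s
  rw [Finsupp.sum, Finset.sum_apply] at h2
  exact h2

/-- The sum of the `conj (a ξ) * (g (Π ξ) | ξ)`. -/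
def pairing (a : (Σ z, D z) →₀ ℂ) (g : ∀ z, D z) : ℂ :=
  a.sum fun ξ c => conj c * inner ℂ ξ.2 (g ξ.1)

/-- The scalar product on the span of the sections `K_ξ`, obtained by sesquilinearity from
`(K_ξ | K_η) = (K(Π(η), Π(ξ)) ξ | η)`; here `form f g = (g | f)`. -/
def form (f g : K.PreHilbert) : ℂ := pairing (K.coeff f) (K.toSection g)

theorem pairing_symm (a b : (Σ z, D z) →₀ ℂ) (f g : ∀ z, D z)
    (hf : ∀ s, (a.sum fun ξ c => c • K.sec ξ s) = f s)
    (hg : ∀ s, (b.sum fun ξ c => c • K.sec ξ s) = g s) :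
    pairing a g = conj (pairing b f) := by
  simp only [pairing, ← hf, ← hg, Finsupp.sum, inner_sum, inner_smul_right, Finset.mul_sum,
    map_sum, map_mul, Complex.conj_conj]
  rw [Finset.sum_comm]
  refine Finset.sum_congr rfl fun η _ => Finset.sum_congr rfl fun ξ _ => ?_
  rw [sec, sec, K.inner_symm]
  ring

theorem conj_form (f g : K.PreHilbert) : conj (K.form g f) = K.form f g :=
  (K.pairing_symm _ _ _ _ (K.coeff_spec f) (K.coeff_spec g)).symm

theorem form_eq_pairing (a : (Σ z, D z) →₀ ℂ) (f g : K.PreHilbert)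
    (hf : ∀ s, (a.sum fun ξ c => c • K.sec ξ s) = K.toSection f s) :
    K.form f g = pairing a (K.toSection g) := by
  rw [← K.conj_form, form]
  exact (K.pairing_symm _ _ _ _ hf (K.coeff_spec g)).symm

/-- The reproducing property `(f | K_ξ) = (f(Π(ξ)) | ξ)` on the span. -/
theorem form_preSec (ξ : Σ z, D z) (f : K.PreHilbert) :
    K.form (K.preSec ξ) f = inner ℂ ξ.2 (K.toSection f ξ.1) := by
  rw [K.form_eq_pairing (Finsupp.single ξ 1)]
  · simp [pairing]
  · intro s
    simp [toSection_preSec]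

theorem form_add_right (f g h : K.PreHilbert) :
    K.form f (g + h) = K.form f g + K.form f h := by
  simp only [form, map_add, pairing, Pi.add_apply, inner_add_right, mul_add,
    Finsupp.sum, Finset.sum_add_distrib]

theorem form_smul_right (f g : K.PreHilbert) (r : ℂ) :
    K.form f (r • g) = r * K.form f g := by
  simp only [form, map_smul, pairing, Pi.smul_apply, inner_smul_right,
    Finsupp.sum, Finset.mul_sum]
  exact Finset.sum_congr rfl fun _ _ => by ring

theorem re_form_nonneg (f : K.PreHilbert) : 0 ≤ (K.form f f).re := by
  have h : K.form f f = ∑ η ∈ (K.coeff f).support, ∑ ξ ∈ (K.coeff f).support,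
      inner ℂ (K.coeff f ξ • ξ.2) (K.toFun ξ.1 η.1 (K.coeff f η • η.2)) := by
    rw [form, pairing, Finsupp.sum, Finset.sum_comm]
    refine Finset.sum_congr rfl fun ξ _ => ?_
    rw [← K.coeff_spec f, Finsupp.sum, inner_sum, Finset.mul_sum]
    refine Finset.sum_congr rfl fun η _ => ?_
    simp only [sec, inner_smul_left, inner_smul_right, map_smul]
    ring
  have hp := K.posDef (K.coeff f).support.card
    (fun j => ((K.coeff f).support.equivFin.symm j).1.1)
    (fun j => K.coeff f ((K.coeff f).support.equivFin.symm j).1 •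
      ((K.coeff f).support.equivFin.symm j).1.2)
  have h2 : K.form f f = ∑ j, ∑ l, inner ℂ
      (K.coeff f ((K.coeff f).support.equivFin.symm l).1 •
        ((K.coeff f).support.equivFin.symm l).1.2)
      (K.toFun ((K.coeff f).support.equivFin.symm l).1.1
        ((K.coeff f).support.equivFin.symm j).1.1
        (K.coeff f ((K.coeff f).support.equivFin.symm j).1 •
          ((K.coeff f).support.equivFin.symm j).1.2)) := by
    rw [h, ← Finset.sum_coe_sort, ← (K.coeff f).support.equivFin.symm.sum_comp]
    refine Finset.sum_congr rfl fun j _ => ?_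
    rw [← Finset.sum_coe_sort, ← (K.coeff f).support.equivFin.symm.sum_comp]
  rw [← h2] at hp
  exact (Complex.le_def.1 hp).1

/-- The semidefinite form, for the Cauchy-Schwarz inequality. -/
@[reducible]
def preCore : PreInnerProductSpace.Core ℂ K.PreHilbert where
  inner := K.form
  conj_inner_symm := K.conj_form
  re_inner_nonneg := K.re_form_nonneg
  add_left := fun f g h => by
    rw [← K.conj_form, K.form_add_right, map_add, K.conj_form, K.conj_form]
  smul_left := fun f g r => by
    rw [← K.conj_form, K.form_smul_right, map_mul, K.conj_form]

theorem form_definite (f : K.PreHilbert) (hf : K.form f f = 0) : f = 0 := by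
  apply K.toSection_injective
  rw [map_zero]
  funext s
  have h := @InnerProductSpace.Core.inner_mul_inner_self_le ℂ K.PreHilbert _ _ _ K.preCore
    (K.preSec ⟨s, K.toSection f s⟩) f
  change ‖K.form (K.preSec ⟨s, K.toSection f s⟩) f‖ * ‖K.form f (K.preSec ⟨s, K.toSection f s⟩)‖
    ≤ _ * RCLike.re (K.form f f) at h
  rw [hf, map_zero, mul_zero, ← K.conj_form f, RCLike.norm_conj, K.form_preSec] at h
  have h2 : ‖inner ℂ (K.toSection f s) (K.toSection f s)‖ = 0 :=
    mul_self_eq_zero.1 (le_antisymm h (mul_self_nonneg _))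
  exact inner_self_eq_zero.1 (norm_eq_zero.1 h2)

/-- The scalar product on the span of the sections `K_ξ`. -/
@[reducible]
def core : InnerProductSpace.Core ℂ K.PreHilbert where
  toCore := K.preCore
  definite := K.form_definite

instance : NormedAddCommGroup K.PreHilbert := K.core.toNormedAddCommGroup

instance : InnerProductSpace ℂ K.PreHilbert := InnerProductSpace.ofCore K.core.toCore

theorem inner_eq_form (f g : K.PreHilbert) : inner ℂ f g = K.form f g := rfl

/-- The reproducing kernel Hilbert space of `K`: the completion of the span of the sections. -/
abbrev Hilb : Type (max u u₁) := UniformSpace.Completion K.PreHilbert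

/-- The map `ξ ↦ K_ξ` on the total space, with values in the reproducing kernel Hilbert space. -/
def hat (ξ : Σ z, D z) : K.Hilb := (K.preSec ξ : K.Hilb)

theorem inner_hat (ξ η : Σ z, D z) :
    inner ℂ (K.hat η) (K.hat ξ) = inner ℂ η.2 (K.toFun η.1 ξ.1 ξ.2) := by
  rw [hat, hat, UniformSpace.Completion.inner_coe]
  exact K.form_preSec η (K.preSec ξ)

/-- The restriction of `hat` to the fiber over `s`, as a bounded linear operator. -/
def hatFiber (s : Z) : D s →L[ℂ] K.Hilb :=
  LinearMap.mkContinuous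
    { toFun := fun x => K.hat ⟨s, x⟩
      map_add' := fun x y => by
        have h : K.preSec ⟨s, x + y⟩ = K.preSec ⟨s, x⟩ + K.preSec ⟨s, y⟩ := by
          apply K.toSection_injective
          funext t
          simp [toSection_preSec, sec]
        simp only [hat, h, UniformSpace.Completion.coe_add]
      map_smul' := fun c x => by
        have h : K.preSec ⟨s, c • x⟩ = c • K.preSec ⟨s, x⟩ := by
          apply K.toSection_injective
          funext t
          simp [toSection_preSec, sec]
        simp only [hat, h, UniformSpace.Completion.coe_smul, RingHom.id_apply] }
    (Real.sqrt ‖K.toFun s s‖) (fun x => by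
      change ‖K.hat ⟨s, x⟩‖ ≤ _
      have h1 : ‖K.hat ⟨s, x⟩‖ ^ 2 ≤ ‖K.toFun s s‖ * ‖x‖ ^ 2 := by
        rw [← inner_self_eq_norm_sq (𝕜 := ℂ) (K.hat ⟨s, x⟩), K.inner_hat]
        calc RCLike.re (inner ℂ x (K.toFun s s x)) ≤ ‖x‖ * ‖K.toFun s s x‖ :=
              re_inner_le_norm _ _
          _ ≤ ‖x‖ * (‖K.toFun s s‖ * ‖x‖) := by
              gcongr
              exact (K.toFun s s).le_opNorm x
          _ = ‖K.toFun s s‖ * ‖x‖ ^ 2 := by ring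
      rw [← Real.sqrt_sq (norm_nonneg x), ← Real.sqrt_mul (norm_nonneg _)]
      exact Real.le_sqrt_of_sq_le h1)

theorem hatFiber_apply (s : Z) (x : D s) : K.hatFiber s x = K.hat ⟨s, x⟩ := rfl

/-- The map `ζ_K` into the Grassmannian: `s` is sent to the closure of the image of the fiber. -/
def zeta (s : Z) : Gr K.Hilb := (K.hatFiber s).range.closure

theorem hatFiber_mem_zeta (s : Z) (x : D s) : K.hatFiber s x ∈ (K.zeta s).toSubmodule :=
  Submodule.le_topologicalClosure _ ⟨x, rfl⟩

/-- Admissible kernels: smooth as sections of `Hom(p₂^*Π, p₁^*Π)`, with invertible `K(s, s)`, and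
with smooth map into the Grassmannian. -/
structure IsAdmissible : Prop where
  smooth : ∀ i j k l, ContDiffOn ℝ ∞
    (fun p : A.Model k × A.Model l =>
      (B.toFib i ((A.chart k).symm p.1) ∘L K.toFun ((A.chart k).symm p.1) ((A.chart l).symm p.2) ∘L
        B.ofFib j ((A.chart l).symm p.2) : B.Fib j →L[ℂ] B.Fib i))
    (((A.chart k).target ∩ (A.chart k).symm ⁻¹' B.dom i) ×ˢ
      ((A.chart l).target ∩ (A.chart l).symm ⁻¹' B.dom j))
  isUnit : ∀ s, IsUnit (K.toFun s s)
  smooth_zeta : A.Smooth (Gr.atlas K.Hilb) K.zeta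

end ReproducingKernel

/-! ## Quasimorphisms -/

/-- A quasimorphism: a map `base` of the base spaces and a map `total` of the total spaces over it
that is linear and bounded on the fibers (given by its restrictions `fib z` to the fibers). -/
structure Quasimorphism {Z : Type u} (D : Z → Type u₁)
    [∀ z, NormedAddCommGroup (D z)] [∀ z, InnerProductSpace ℂ (D z)]
    {Y : Type u₂} (D' : Y → Type v₂)
    [∀ y, NormedAddCommGroup (D' y)] [∀ y, InnerProductSpace ℂ (D' y)] where
  base : Z → Y
  fib : ∀ z, D z →L[ℂ] D' (base z)

namespace Quasimorphism

variable {Z : Type u} {D : Z → Type u₁}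
  [∀ z, NormedAddCommGroup (D z)] [∀ z, InnerProductSpace ℂ (D z)]
  {Y : Type u₂} {D' : Y → Type v₂}
  [∀ y, NormedAddCommGroup (D' y)] [∀ y, InnerProductSpace ℂ (D' y)]

/-- The map of the total spaces. -/
def total (Θ : Quasimorphism D D') (p : Σ z, D z) : Σ y, D' y := ⟨Θ.base p.1, Θ.fib p.1 p.2⟩

/-- Composition of quasimorphisms. -/
def comp {X : Type v} {C : X → Type w} [∀ x, NormedAddCommGroup (C x)]
    [∀ x, InnerProductSpace ℂ (C x)] (Ψ : Quasimorphism D D') (Θ : Quasimorphism C D) :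
    Quasimorphism C D' where
  base := Ψ.base ∘ Θ.base
  fib := fun x => Ψ.fib (Θ.base x) ∘L Θ.fib x

variable [∀ z, CompleteSpace (D z)] [∀ y, CompleteSpace (D' y)]

/-- The pull-back of a kernel: `(Θ^*K)(s, t) = δ_s^* ∘ K(ζ(s), ζ(t)) ∘ δ_t` for `Θ = (δ, ζ)`. -/
def pullbackKernel (Θ : Quasimorphism D D') (K : ∀ s t, D' t →L[ℂ] D' s) (s t : Z) :
    D t →L[ℂ] D s :=
  ContinuousLinearMap.adjoint (Θ.fib s) ∘L K (Θ.base s) (Θ.base t) ∘L Θ.fib t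

variable {A : BanachAtlas.{u, v, w} Z} {C : BanachAtlas.{u₂, v₁, w₂} Y}

/-- A quasimorphism is smooth if both its components are smooth maps. -/
def Smooth (Θ : Quasimorphism D D') (B : HermitianBundle A D) (B' : HermitianBundle C D') : Prop :=
  B.totalAtlas.Smooth B'.totalAtlas Θ.total ∧ A.Smooth C Θ.base

/-- Morphisms of smooth vector bundles: smooth on the bases, and represented in trivializations by
operator-valued functions that are smooth with respect to the operator norm. -/
def IsBundleMorphism (Θ : Quasimorphism D D') (B : HermitianBundle A D)
    (B' : HermitianBundle C D') : Prop :=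
  A.Smooth C Θ.base ∧ ∀ i j, A.SmoothOn (B.dom i ∩ Θ.base ⁻¹' B'.dom j)
    (fun z => B'.toFib j (Θ.base z) ∘L Θ.fib z ∘L B.ofFib i z)

/-- Isomorphisms of smooth vector bundles: morphisms that have an inverse morphism. -/
def IsBundleIso (Θ : Quasimorphism D D') (B : HermitianBundle A D)
    (B' : HermitianBundle C D') : Prop :=
  Θ.IsBundleMorphism B B' ∧ ∃ Ψ : Quasimorphism D' D, Ψ.IsBundleMorphism B' B ∧
    Function.LeftInverse Ψ.total Θ.total ∧ Function.RightInverse Ψ.total Θ.total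

end Quasimorphism

/-! ## The morphisms attached to a kernel -/

namespace Gr

variable {H : Type u} [NormedAddCommGroup H] [InnerProductSpace ℂ H] [CompleteSpace H]

variable (H) in
/-- The universal reproducing kernel `Q_H(S₁, S₂) = p_{S₁}|_{S₂}` of the tautological bundle. -/
def universalKernel (S₁ S₂ : Gr H) : S₂.space →L[ℂ] S₁.space := proj S₁ S₂

/-- The kernel `K_ζ(s, t) = p_{ζ(s)}|_{ζ(t)}` of the bundle of the pairs `(s, x)`, `x ∈ ζ(s)`. -/
def mapKernel {Z : Type u₁} (ζ : Z → Gr H) (s t : Z) : (ζ t).space →L[ℂ] (ζ s).space :=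
  proj (ζ s) (ζ t)

/-- The bundle of the pairs `(s, x)` with `x ∈ ζ(s)`: the pull-back of the tautological bundle
through the smooth map `ζ`. -/
def mapBundle {Z : Type u₁} {A : BanachAtlas.{u₁, v, w} Z} (ζ : Z → Gr H)
    (hζ : A.Smooth (atlas H) ζ) :
    HermitianBundle.{u₁, v, w, u, u, u} A (fun s => (ζ s).space) :=
  (tautological H).pullback ζ hζ

/-- The quasimorphism `(ψ_ζ, ζ)`, `ψ_ζ(s, x) = (ζ(s), x)`. -/
def mapMorphism {Z : Type u₁} (ζ : Z → Gr H) :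
    Quasimorphism (fun s => (ζ s).space) (fun S : Gr H => S.space) where
  base := ζ
  fib := fun s => ContinuousLinearMap.id ℂ (ζ s).space

end Gr

namespace ReproducingKernel

variable {Z : Type u} {A : BanachAtlas.{u, v, w} Z} {D : Z → Type u₁}
  [∀ z, NormedAddCommGroup (D z)] [∀ z, InnerProductSpace ℂ (D z)] [∀ z, CompleteSpace (D z)]
  {B : HermitianBundle.{u, v, w, u₁, v₁, w₁} A D} (K : ReproducingKernel B)

theorem hat_mem_zeta (ξ : Σ z, D z) : K.hat ξ ∈ (K.zeta ξ.1).toSubmodule :=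
  K.hatFiber_mem_zeta ξ.1 ξ.2

/-- The map `ξ ↦ (Π(ξ), K_ξ)`. -/
def check (ξ : Σ z, D z) : Σ s, (K.zeta s).space := ⟨ξ.1, K.hat ξ, K.hat_mem_zeta ξ⟩

/-- The map `δ_K`, `ξ ↦ (ζ_K(Π(ξ)), K_ξ)`. -/
def delta (ξ : Σ z, D z) : Σ S : Gr K.Hilb, S.space := ⟨K.zeta ξ.1, K.hat ξ, K.hat_mem_zeta ξ⟩

/-- The quasimorphism formed by the map `check` and the identity of the base. -/
def checkMorphism : Quasimorphism D (fun s => (K.zeta s).space) where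
  base := fun s => s
  fib := fun s => (K.hatFiber s).codRestrict (K.zeta s).toSubmodule (K.hatFiber_mem_zeta s)

theorem checkMorphism_total : K.checkMorphism.total = K.check := rfl

/-- The classifying quasimorphism `(δ_K, ζ_K)`. -/
def classifying : Quasimorphism D (fun S : Gr K.Hilb => S.space) where
  base := K.zeta
  fib := fun s => (K.hatFiber s).codRestrict (K.zeta s).toSubmodule (K.hatFiber_mem_zeta s)

theorem classifying_total : K.classifying.total = K.delta := rfl

end ReproducingKernel

end

/-! Write T_s : D_s → ζ_K(s) for the map x ↦ K_x (`zetaFiber`). Everything follows from the identity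
T_s^* p_{ζ(s)} T_t = K(s,t), which is the definition of the scalar product on H^K in operator form
(`adjoint_zetaFiber_comp`) and already contains all the kernel identities.

For s = t, invertibility of K(s,s) makes K(s,s)⁻¹ T_s^* a bounded left inverse of T_s. Hence the
range of x ↦ K_x is closed, it equals ζ_K(s), and T_s is an isomorphism (`isInvertible_zetaFiber`).

For fixed s and variable t, cancelling T_s^* gives p_{ζ(s)} T_t = L K(s,t), with L independent of t.
So near s, read in the trivialization of the tautological bundle at ζ_K(s), the family T is as
smooth as K(s,·); the smooth transition functions of that bundle, composed with the smooth map ζ_K,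
carry this to every other trivialization (`smoothOn_proj_zetaFiber`).

The rest is general: a morphism over the identity that is smooth in the operator norm and fiberwise
invertible has a smooth inverse, because operator inversion is smooth; and smoothness in the
operator norm implies smoothness of the map of total spaces. -/

/-! ### Real smoothness of families of complex-linear operators -/

/-- Composition of operators is ℂ-bilinear and bounded, hence smooth over ℂ. Scalars are restricted
only afterwards, since the parameter space is merely real. -/
theorem contDiffOn_clm_comp_real {X : Type*} [NormedAddCommGroup X] [NormedSpace ℝ X]
    {E F G : Type*} [NormedAddCommGroup E] [NormedSpace ℂ E] [NormedAddCommGroup F]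
    [NormedSpace ℂ F] [NormedAddCommGroup G] [NormedSpace ℂ G] {s : Set X}
    {g : X → F →L[ℂ] G} {f : X → E →L[ℂ] F} (hg : ContDiffOn ℝ ∞ g s) (hf : ContDiffOn ℝ ∞ f s) :
    ContDiffOn ℝ ∞ (fun x => g x ∘L f x) s := by
  have h : ContDiff ℂ ∞ (fun p : (F →L[ℂ] G) × (E →L[ℂ] F) => p.1 ∘L p.2) :=
    contDiff_fst.clm_comp contDiff_snd
  exact (h.restrict_scalars ℝ).comp_contDiffOn (hg.prodMk hf)

theorem contDiffOn_clm_inverse_real {X : Type*} [NormedAddCommGroup X] [NormedSpace ℝ X]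
    {E F : Type*} [NormedAddCommGroup E] [NormedSpace ℂ E] [CompleteSpace E]
    [NormedAddCommGroup F] [NormedSpace ℂ F] {s : Set X}
    {f : X → E →L[ℂ] F} (hf : ContDiffOn ℝ ∞ f s) (hi : ∀ x ∈ s, (f x).IsInvertible) :
    ContDiffOn ℝ ∞ (fun x => (f x).inverse) s := fun x hx =>
  ContDiffAt.comp_contDiffWithinAt (g := ContinuousLinearMap.inverse) x
    (((hi x hx).contDiffAt_map_inverse (𝕜 := ℂ)).restrict_scalars ℝ) (hf x hx)

/-! ### Smooth functions on open subsets of a Banach manifold -/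

namespace BanachAtlas

variable {M : Type u}

theorem IsOpenSet.inter {A : BanachAtlas.{u, v, w} M} {V W : Set M} (hV : A.IsOpenSet V)
    (hW : A.IsOpenSet W) : A.IsOpenSet (V ∩ W) := fun k => by
  have h := (hV k).inter (hW k)
  rwa [← Set.inter_inter_distrib_left, ← Set.preimage_inter] at h

theorem SmoothOn.mono {A : BanachAtlas.{u, v, w} M} {E : Type*} [NormedAddCommGroup E]
    [NormedSpace ℝ E] {V W : Set M} {f : M → E} (hf : A.SmoothOn V f) (h : W ⊆ V) :
    A.SmoothOn W f := fun k => (hf k).mono fun _ he => ⟨he.1, h he.2⟩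

theorem SmoothOn.congr {A : BanachAtlas.{u, v, w} M} {E : Type*} [NormedAddCommGroup E]
    [NormedSpace ℝ E] {V : Set M} {f g : M → E} (hf : A.SmoothOn V f)
    (h : ∀ z ∈ V, g z = f z) : A.SmoothOn V g := fun k =>
  (hf k).congr fun _ he => h _ he.2

/-- Smoothness is a local property. -/
theorem smoothOn_of_locally {A : BanachAtlas.{u, v, w} M} {E : Type*} [NormedAddCommGroup E]
    [NormedSpace ℝ E] {V : Set M} {f : M → E}
    (h : ∀ z ∈ V, ∃ W, z ∈ W ∧ A.IsOpenSet W ∧ A.SmoothOn W f) : A.SmoothOn V f := by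
  rintro k e ⟨he, heV⟩
  obtain ⟨W, hz, hW, hf⟩ := h _ heV
  -- Openness of `W` upgrades smoothness within `W` to smoothness at the point, which then restricts
  -- to any `V`.
  exact ((hf k e ⟨he, hz⟩).contDiffAt ((hW k).mem_nhds ⟨he, hz⟩)).contDiffWithinAt

theorem SmoothOn.clm_comp {A : BanachAtlas.{u, v, w} M} {V : Set M}
    {E F G : Type*} [NormedAddCommGroup E] [NormedSpace ℂ E] [NormedAddCommGroup F]
    [NormedSpace ℂ F] [NormedAddCommGroup G] [NormedSpace ℂ G]
    {g : M → F →L[ℂ] G} {f : M → E →L[ℂ] F} (hg : A.SmoothOn V g) (hf : A.SmoothOn V f) :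
    A.SmoothOn V (fun z => g z ∘L f z) := fun k => contDiffOn_clm_comp_real (hg k) (hf k)

theorem smoothOn_const (A : BanachAtlas.{u, v, w} M) {E : Type*} [NormedAddCommGroup E]
    [NormedSpace ℝ E] (V : Set M) (c : E) : A.SmoothOn V (fun _ => c) := fun _ => contDiffOn_const

theorem SmoothOn.clm_inverse {A : BanachAtlas.{u, v, w} M} {V : Set M}
    {E F : Type*} [NormedAddCommGroup E] [NormedSpace ℂ E] [CompleteSpace E]
    [NormedAddCommGroup F] [NormedSpace ℂ F]
    {f : M → E →L[ℂ] F} (hf : A.SmoothOn V f) (hi : ∀ z ∈ V, (f z).IsInvertible) :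
    A.SmoothOn V (fun z => (f z).inverse) := fun k =>
  contDiffOn_clm_inverse_real (hf k) fun _ he => hi _ he.2

end BanachAtlas

namespace Gr

/-- The transition functions of the tautological bundle are smooth. -/
theorem smoothOn_proj_comp_inverse {H : Type u} [NormedAddCommGroup H] [InnerProductSpace ℂ H]
    [CompleteSpace H] (S T : Gr H) :
    (atlas H).SmoothOn (chartDom S ∩ chartDom T)
      (fun R : Gr H => proj T R ∘L (proj S R).inverse) :=
  (tautological H).smooth_change S T

end Gr

/-! ### Morphisms and isomorphisms of smooth bundles -/

namespace Quasimorphism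

variable {Z : Type u} {D : Z → Type u₁}
  [∀ z, NormedAddCommGroup (D z)] [∀ z, InnerProductSpace ℂ (D z)] [∀ z, CompleteSpace (D z)]
  {Y : Type u₂} {D' : Y → Type v₂}
  [∀ y, NormedAddCommGroup (D' y)] [∀ y, InnerProductSpace ℂ (D' y)] [∀ y, CompleteSpace (D' y)]
  {A : BanachAtlas.{u, v, w} Z} {C : BanachAtlas.{u₂, v₁, w₂} Y}

/-- The map of the total spaces of a morphism of smooth vector bundles is smooth. -/
theorem IsBundleMorphism.smooth_total {Θ : Quasimorphism D D'} {B : HermitianBundle A D}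
    {B' : HermitianBundle C D'} (h : Θ.IsBundleMorphism B B') :
    B.totalAtlas.Smooth B'.totalAtlas Θ.total := by
  rintro ⟨k, i⟩ ⟨l, j⟩
  -- All the conditions on a point of the total space concern its base point only, so the domain is
  -- a product with the whole model fiber.
  have hset : (B.totalChart k i).target ∩ (B.totalChart k i).symm ⁻¹'
        (Θ.total ⁻¹' (B'.totalChart l j).source) =
      (((A.chart k).target ∩ (A.chart k).symm ⁻¹' (Θ.base ⁻¹' (C.chart l).source)) ∩
        ((A.chart k).target ∩ (A.chart k).symm ⁻¹' (B.dom i ∩ Θ.base ⁻¹' B'.dom j))) ×ˢ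
        Set.univ := by
    ext ⟨e, y⟩
    simp only [HermitianBundle.totalChart, total, Set.mem_inter_iff, Set.mem_prod, Set.mem_univ,
      Set.mem_preimage, Set.mem_ofPred_eq, PartialEquiv.coe_symm_mk]
    tauto
  change IsOpen ((B.totalChart k i).target ∩ (B.totalChart k i).symm ⁻¹'
        (Θ.total ⁻¹' (B'.totalChart l j).source)) ∧
    ContDiffOn ℝ ∞ (B'.totalChart l j ∘ Θ.total ∘ (B.totalChart k i).symm)
      ((B.totalChart k i).target ∩ (B.totalChart k i).symm ⁻¹'
        (Θ.total ⁻¹' (B'.totalChart l j).source))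
  rw [hset]
  refine ⟨((h.1 k l).1.inter (((B.isOpen_dom i).inter
    (h.1.isOpenSet_preimage (B'.isOpen_dom j))) k)).prod isOpen_univ, ?_⟩
  have h1 := (h.1 k l).2.comp (contDiff_fst (E := A.Model k) (F := B.Fib i)).contDiffOn
    (fun p (hp : p ∈ (((A.chart k).target ∩
      (A.chart k).symm ⁻¹' (Θ.base ⁻¹' (C.chart l).source)) ∩
      ((A.chart k).target ∩ (A.chart k).symm ⁻¹' (B.dom i ∩ Θ.base ⁻¹' B'.dom j))) ×ˢ
      (Set.univ : Set (B.Fib i))) => hp.1.1)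
  have h2 := (h.2 i j k).comp (contDiff_fst (E := A.Model k) (F := B.Fib i)).contDiffOn
    (fun p (hp : p ∈ (((A.chart k).target ∩
      (A.chart k).symm ⁻¹' (Θ.base ⁻¹' (C.chart l).source)) ∩
      ((A.chart k).target ∩ (A.chart k).symm ⁻¹' (B.dom i ∩ Θ.base ⁻¹' B'.dom j))) ×ˢ
      (Set.univ : Set (B.Fib i))) => hp.1.2)
  -- The fiber component is `(e, y) ↦ T(e) y`. It is jointly smooth because `T` is smooth in the
  -- operator norm and evaluation is bounded and bilinear.
  exact h1.prodMk (((ContinuousLinearMap.contDiff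
    (ContinuousLinearMap.restrictScalarsL ℂ (B.Fib i) (B'.Fib j) ℝ ℝ)).comp_contDiffOn
      h2).clm_apply contDiff_snd.contDiffOn)

/-- An isomorphism of smooth vector bundles is a diffeomorphism of the total spaces. -/
theorem IsBundleIso.diffeomorphism_total {Θ : Quasimorphism D D'} {B : HermitianBundle A D}
    {B' : HermitianBundle C D'} (h : Θ.IsBundleIso B B') :
    B.totalAtlas.Diffeomorphism B'.totalAtlas Θ.total := by
  obtain ⟨h1, Ψ, h2, hl, hr⟩ := h
  exact ⟨h1.smooth_total, Ψ.total, hl, hr, h2.smooth_total⟩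

/-- A morphism over the identity that is invertible on every fiber is an isomorphism. -/
theorem isBundleIso_of_isInvertible {D₁ : Z → Type v₂}
    [∀ z, NormedAddCommGroup (D₁ z)] [∀ z, InnerProductSpace ℂ (D₁ z)]
    [∀ z, CompleteSpace (D₁ z)] (f : ∀ z, D z →L[ℂ] D₁ z) {B : HermitianBundle A D}
    {B' : HermitianBundle A D₁}
    (h : (Quasimorphism.mk (fun z => z) f).IsBundleMorphism B B')
    (hf : ∀ z, (f z).IsInvertible) :
    (Quasimorphism.mk (fun z => z) f).IsBundleIso B B' := by
  refine ⟨h, ⟨fun z => z, fun z => (f z).inverse⟩, ⟨BanachAtlas.Smooth.id A, fun j i => ?_⟩, ?_, ?_⟩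
  -- In trivializations, the representative of the fiberwise inverse is the inverse of the
  -- representative of `f`, so its smoothness reduces to that of operator inversion.
  · have h1 : ∀ z ∈ B.dom i ∩ B'.dom j,
        ∃ Φ : B.Fib i ≃L[ℂ] B'.Fib j,
          (Φ : B.Fib i →L[ℂ] B'.Fib j) = B'.toFib j z ∘L f z ∘L B.ofFib i z ∧
          (Φ.symm : B'.Fib j →L[ℂ] B.Fib i) =
            B.toFib i z ∘L (f z).inverse ∘L B'.ofFib j z := by
      rintro z ⟨hi, hj⟩
      refine ⟨ContinuousLinearEquiv.equivOfInverse (B'.toFib j z ∘L f z ∘L B.ofFib i z)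
        (B.toFib i z ∘L (f z).inverse ∘L B'.ofFib j z) (fun x => ?_) (fun y => ?_), rfl, rfl⟩
      · simp [B'.ofFib_toFib j z hj, B.toFib_ofFib i z hi, (hf z).inverse_apply_self]
      · simp [B.ofFib_toFib i z hi, B'.toFib_ofFib j z hj, (hf z).self_apply_inverse]
    have h2 := (h.2 i j).clm_inverse (fun z hz => by
      obtain ⟨Φ, hΦ, -⟩ := h1 z hz
      exact ⟨Φ, hΦ⟩)
    refine (h2.congr fun z hz => ?_).mono (W := B'.dom j ∩ B.dom i) (fun z hz => hz.symm)
    obtain ⟨Φ, hΦ, hΦ'⟩ := h1 z hz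
    change B.toFib i z ∘L (f z).inverse ∘L B'.ofFib j z =
      (B'.toFib j z ∘L f z ∘L B.ofFib i z).inverse
    rw [← hΦ, ← hΦ', ContinuousLinearMap.inverse_equiv]
  · rintro ⟨z, x⟩
    exact Sigma.ext rfl (heq_of_eq ((hf z).inverse_apply_self x))
  · rintro ⟨z, x⟩
    exact Sigma.ext rfl (heq_of_eq ((hf z).self_apply_inverse x))

end Quasimorphism

/-! ### The fiber maps of a kernel into its reproducing kernel Hilbert space -/

namespace ReproducingKernel

variable {Z : Type u} {A : BanachAtlas.{u, v, w} Z} {D : Z → Type u₁}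
  [∀ z, NormedAddCommGroup (D z)] [∀ z, InnerProductSpace ℂ (D z)] [∀ z, CompleteSpace (D z)]
  {B : HermitianBundle.{u, v, w, u₁, v₁, w₁} A D} (K : ReproducingKernel B)

/-- This is `inner_hat` in operator form. The case `s = t` turns invertibility of `K(s, s)` into a
left inverse of `hatFiber s`. -/
theorem adjoint_hatFiber_comp_hatFiber (s t : Z) :
    ContinuousLinearMap.adjoint (K.hatFiber s) ∘L K.hatFiber t = K.toFun s t := by
  ext x
  refine ext_inner_left ℂ fun y => ?_
  rw [ContinuousLinearMap.comp_apply, ContinuousLinearMap.adjoint_inner_right,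
    hatFiber_apply, hatFiber_apply, inner_hat]

/-- The restriction of `hat` to the fiber over `s`, with values in `ζ_K(s)`. -/
noncomputable def zetaFiber (s : Z) : D s →L[ℂ] (K.zeta s).space :=
  (K.hatFiber s).codRestrict (K.zeta s).toSubmodule (K.hatFiber_mem_zeta s)

/-- Against a vector of `ζ_K(s)` the projection onto `ζ_K(s)` can be dropped, which leaves the
scalar product of two sections `K_ξ`. -/
theorem adjoint_zetaFiber_comp (s t : Z) :
    ContinuousLinearMap.adjoint (K.zetaFiber s) ∘L Gr.proj (K.zeta s) (K.zeta t) ∘L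
      K.zetaFiber t = K.toFun s t := by
  ext x
  refine ext_inner_left ℂ fun y => ?_
  rw [ContinuousLinearMap.comp_apply, ContinuousLinearMap.adjoint_inner_right]
  change inner ℂ (K.zetaFiber s y) ((K.zeta s).toSubmodule.orthogonalProjectionOnto
    (K.hatFiber t x)) = _
  rw [Submodule.inner_orthogonalProjectionOnto_eq_of_mem_left]
  exact K.inner_hat ⟨t, x⟩ ⟨s, y⟩

variable {K}

/-- The operator `K(s, s)⁻¹ ∘ (hatFiber s)^*` is a bounded left inverse of `hatFiber s`. It also
inverts on the right over the range and, by continuity, over the closure of the range, which is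
`ζ_K(s)`. -/
theorem IsAdmissible.isInvertible_zetaFiber (hK : K.IsAdmissible) (s : Z) :
    (K.zetaFiber s).IsInvertible := by
  obtain ⟨u, hu⟩ := hK.isUnit s
  have hT : ∀ x, (↑u⁻¹ : D s →L[ℂ] D s)
      (ContinuousLinearMap.adjoint (K.hatFiber s) (K.hatFiber s x)) = x := fun x => by
    have h1 := congrArg (fun L : D s →L[ℂ] D s => L x) (K.adjoint_hatFiber_comp_hatFiber s s)
    simp only [ContinuousLinearMap.comp_apply] at h1
    rw [h1, ← hu, ← mul_apply_eq_comp, Units.inv_mul, one_apply_eq_self]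
  -- the range of `hatFiber` is the set of fixed points of a bounded operator
  have hr : ∀ y ∈ (K.zeta s).toSubmodule, K.hatFiber s ((↑u⁻¹ : D s →L[ℂ] D s)
      (ContinuousLinearMap.adjoint (K.hatFiber s) y)) = y := by
    intro y hy
    have hc : IsClosed {y : K.Hilb | K.hatFiber s ((↑u⁻¹ : D s →L[ℂ] D s)
      (ContinuousLinearMap.adjoint (K.hatFiber s) y)) = y} :=
      isClosed_eq (by fun_prop) continuous_id
    have hsub : ((K.hatFiber s).range : Set K.Hilb) ⊆ {y : K.Hilb | K.hatFiber s
        ((↑u⁻¹ : D s →L[ℂ] D s) (ContinuousLinearMap.adjoint (K.hatFiber s) y)) = y} := by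
      rintro _ ⟨x, rfl⟩
      exact congrArg (K.hatFiber s) (hT x)
    exact closure_minimal hsub hc hy
  exact ⟨ContinuousLinearEquiv.equivOfInverse (K.zetaFiber s)
    ((↑u⁻¹ : D s →L[ℂ] D s) ∘L ContinuousLinearMap.adjoint (K.hatFiber s) ∘L
      (K.zeta s).toSubmodule.subtypeL) hT (fun y => Subtype.ext (hr y y.2)), rfl⟩

/-- Composition with the projection onto a fixed `ζ_K(s)` is determined by `K(s, ·)`. -/
theorem IsAdmissible.exists_comp_eq_proj_comp (hK : K.IsAdmissible) (s : Z) :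
    ∃ L : D s →L[ℂ] (K.zeta s).space, ∀ t,
      Gr.proj (K.zeta s) (K.zeta t) ∘L K.zetaFiber t = L ∘L K.toFun s t := by
  obtain ⟨Φ, hΦ⟩ := hK.isInvertible_zetaFiber s
  -- Since `K(s, t)` is `Φ^*` composed with the left-hand side, `L` has to cancel `Φ^*`: `(Φ⁻¹)^*
  -- Φ^* = (Φ Φ⁻¹)^* = id`.
  refine ⟨ContinuousLinearMap.adjoint (Φ.symm : (K.zeta s).space →L[ℂ] D s), fun t => ?_⟩
  rw [← K.adjoint_zetaFiber_comp s t, ← ContinuousLinearMap.comp_assoc,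
    ← ContinuousLinearMap.adjoint_comp, ← hΦ, ContinuousLinearEquiv.coe_comp_coe_symm,
    ContinuousLinearMap.adjoint_id, ContinuousLinearMap.id_comp]

/-- The map `z ↦ K_z` is smooth in the trivializations of `Π` and of the tautological bundle. -/
theorem IsAdmissible.smoothOn_proj_zetaFiber (hK : K.IsAdmissible) (i : B.Triv) (S : Gr K.Hilb) :
    A.SmoothOn (B.dom i ∩ K.zeta ⁻¹' Gr.chartDom S)
      (fun z => Gr.proj S (K.zeta z) ∘L K.zetaFiber z ∘L B.ofFib i z) := by
  -- Near `s`, the trivialization of the tautological bundle at `ζ_K(s)` is used first, because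
  -- there the family is `L ∘ K(s, ·)`; the passage to the one at `S` comes after.
  refine BanachAtlas.smoothOn_of_locally fun s hs => ?_
  have hdom : ∀ T : Gr K.Hilb, A.IsOpenSet (K.zeta ⁻¹' Gr.chartDom T) := fun T =>
    hK.smooth_zeta.isOpenSet_preimage ((Gr.tautological K.Hilb).isOpen_dom T)
  have hmem : K.zeta s ∈ Gr.chartDom (K.zeta s) := by
    refine ⟨ContinuousLinearEquiv.refl ℂ _, ?_⟩
    ext x
    simp [Gr.proj]
  refine ⟨B.dom i ∩ (K.zeta ⁻¹' Gr.chartDom (K.zeta s) ∩ K.zeta ⁻¹' Gr.chartDom S),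
    ⟨hs.1, hmem, hs.2⟩, (B.isOpen_dom i).inter ((hdom _).inter (hdom S)), ?_⟩
  obtain ⟨L, hL⟩ := hK.exists_comp_eq_proj_comp s
  -- The first variable of the smooth kernel is frozen at the coordinate of `s` in a chart around
  -- `s`.
  have h1 : A.SmoothOn (B.dom i) (fun z => B.toFib i s ∘L K.toFun s z ∘L B.ofFib i z) := by
    intro l
    obtain ⟨k, hk⟩ := A.exists_chart s
    have h := (hK.smooth i i k l).comp
      (contDiff_const.prodMk contDiff_id : ContDiff ℝ ∞ fun e : A.Model l =>
        (A.chart k s, e)).contDiffOn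
      (s := (A.chart l).target ∩ (A.chart l).symm ⁻¹' B.dom i) (fun e he =>
        ⟨⟨(A.chart k).map_source hk, by
          change (A.chart k).symm (A.chart k s) ∈ B.dom i
          rw [(A.chart k).left_inv hk]
          exact hs.1⟩, he⟩)
    refine h.congr fun e _ => ?_
    change B.toFib i s ∘L K.toFun s _ ∘L _ = B.toFib i ((A.chart k).symm (A.chart k s)) ∘L
      K.toFun ((A.chart k).symm (A.chart k s)) _ ∘L _
    rw [(A.chart k).left_inv hk]
  have h2 : A.SmoothOn (K.zeta ⁻¹' (Gr.chartDom (K.zeta s) ∩ Gr.chartDom S))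
      (fun z => Gr.proj S (K.zeta z) ∘L (Gr.proj (K.zeta s) (K.zeta z)).inverse) :=
    (Gr.smoothOn_proj_comp_inverse (K.zeta s) S).comp hK.smooth_zeta
  -- Three smooth factors: the transition from `ζ_K(s)` to `S`, a constant operator, and the local
  -- expression of `K(s, ·)`. The trivialization of `D_s` cancels between the last two.
  refine ((h2.mono fun z hz => hz.2).clm_comp ((A.smoothOn_const _ (L ∘L B.ofFib i s)).clm_comp
    (h1.mono fun z hz => hz.1))).congr fun z hz => ?_
  have h3 : (L ∘L B.ofFib i s) ∘L B.toFib i s ∘L K.toFun s z ∘L B.ofFib i z =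
      Gr.proj (K.zeta s) (K.zeta z) ∘L K.zetaFiber z ∘L B.ofFib i z := by
    rw [← ContinuousLinearMap.comp_assoc (Gr.proj _ _), hL z]
    ext x
    simp [B.ofFib_toFib i s hs.1]
  rw [h3]
  ext x
  simp only [ContinuousLinearMap.comp_apply,
    ContinuousLinearMap.IsInvertible.inverse_apply_self hz.2.1]

theorem IsAdmissible.isBundleMorphism_classifying (hK : K.IsAdmissible) :
    K.classifying.IsBundleMorphism B (Gr.tautological K.Hilb) :=
  ⟨hK.smooth_zeta, hK.smoothOn_proj_zetaFiber⟩

/-- The trivializations of the pull-back at `z` are those of the tautological bundle at `ζ_K(z)`, so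
this morphism has the same local representatives as `classifying`, and one smoothness statement
serves both. -/
theorem IsAdmissible.isBundleIso_checkMorphism (hK : K.IsAdmissible) :
    K.checkMorphism.IsBundleIso B ((Gr.tautological K.Hilb).pullback K.zeta hK.smooth_zeta) :=
  Quasimorphism.isBundleIso_of_isInvertible K.zetaFiber
    ⟨BanachAtlas.Smooth.id A, hK.smoothOn_proj_zetaFiber⟩ hK.isInvertible_zetaFiber

theorem pullbackKernel_checkMorphism (K : ReproducingKernel B) :
    K.checkMorphism.pullbackKernel (Gr.mapKernel K.zeta) = K.toFun :=
  funext fun s => funext fun t => K.adjoint_zetaFiber_comp s t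

theorem pullbackKernel_classifying (K : ReproducingKernel B) :
    K.classifying.pullbackKernel (Gr.universalKernel K.Hilb) = K.toFun :=
  funext fun s => funext fun t => K.adjoint_zetaFiber_comp s t

end ReproducingKernel

/-! ### The universal kernel and the factorization theorem -/

namespace Gr

theorem pullbackKernel_mapMorphism {H : Type u} [NormedAddCommGroup H] [InnerProductSpace ℂ H]
    [CompleteSpace H] {Z : Type u₁} (ζ : Z → Gr H) :
    (mapMorphism ζ).pullbackKernel (universalKernel H) = mapKernel ζ := by
  funext s t
  change ContinuousLinearMap.adjoint (ContinuousLinearMap.id ℂ (ζ s).space) ∘L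
    proj (ζ s) (ζ t) ∘L ContinuousLinearMap.id ℂ (ζ t).space = proj (ζ s) (ζ t)
  rw [ContinuousLinearMap.adjoint_id, ContinuousLinearMap.id_comp, ContinuousLinearMap.comp_id]

end Gr

theorem theorem3p11 {Z : Type u} {A : BanachAtlas.{u, v, w} Z} {D : Z → Type u₁}
    [∀ z, NormedAddCommGroup (D z)] [∀ z, InnerProductSpace ℂ (D z)] [∀ z, CompleteSpace (D z)]
    (B : HermitianBundle.{u, v, w, u₁, v₁, w₁} A D) (K : ReproducingKernel B)
    (hK : K.IsAdmissible) :
    -- `check` is a diffeomorphism over the identity, and an isomorphism of vector bundles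
    (B.totalAtlas.Diffeomorphism (Gr.mapBundle K.zeta hK.smooth_zeta).totalAtlas K.check ∧
      Sigma.fst ∘ K.check = id ∘ Sigma.fst ∧
      K.checkMorphism.total = K.check ∧ K.checkMorphism.base = id ∧
      K.checkMorphism.IsBundleIso B
        ((Gr.tautological K.Hilb).pullback K.zeta hK.smooth_zeta)) ∧
    -- the classifying quasimorphism is smooth and factorizes
    (K.classifying.Smooth B (Gr.tautological K.Hilb) ∧
      K.classifying.total = K.delta ∧ K.classifying.base = K.zeta ∧
      K.delta = (Gr.mapMorphism K.zeta).total ∘ K.check ∧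
      Sigma.fst ∘ (Gr.mapMorphism K.zeta).total = K.zeta ∘ Sigma.fst ∧
      Sigma.fst ∘ K.delta = K.zeta ∘ Sigma.fst ∧
      K.classifying = (Gr.mapMorphism K.zeta).comp K.checkMorphism) ∧
    -- the pull-back relation for the kernels factorizes
    (K.toFun = K.checkMorphism.pullbackKernel (Gr.mapKernel K.zeta) ∧
      K.checkMorphism.pullbackKernel (Gr.mapKernel K.zeta) =
        K.checkMorphism.pullbackKernel
          ((Gr.mapMorphism K.zeta).pullbackKernel (Gr.universalKernel K.Hilb)) ∧
      K.checkMorphism.pullbackKernel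
          ((Gr.mapMorphism K.zeta).pullbackKernel (Gr.universalKernel K.Hilb)) =
        K.classifying.pullbackKernel (Gr.universalKernel K.Hilb)) := by
  refine ⟨⟨hK.isBundleIso_checkMorphism.diffeomorphism_total, rfl, rfl, rfl,
    hK.isBundleIso_checkMorphism⟩,
    -- The factorization is definitional: `classifying` and `checkMorphism` have the same fiber
    -- operators, and those of `mapMorphism` are identities.
    ⟨⟨hK.isBundleMorphism_classifying.smooth_total, hK.smooth_zeta⟩, rfl, rfl, rfl, rfl, rfl, rfl⟩,
    K.pullbackKernel_checkMorphism.symm, ?_, ?_⟩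
  · rw [Gr.pullbackKernel_mapMorphism]
  · rw [Gr.pullbackKernel_mapMorphism, K.pullbackKernel_checkMorphism,
      K.pullbackKernel_classifying]
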